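/- **Conventions.** A naming space is a set $A^Q$ of functions with $Q$, $A$ countable and non-empty. A represented space $\mathbf X$ is a set $X$ with a naming space $\mathcal B_{\mathbf X}=A_{\mathbf X}^{Q_{\mathbf X}}$ and a surjective partial function $\delta_{\mathbf X}\colon{\subseteq\mathcal B_{\mathbf X}}\to X$; if $\delta_{\mathbf X}(\varphi)=x$, then $\varphi$ is a name of $x$. A partial operator $F\colon{\subseteq A^Q}\to A'^{Q'}$ is continuous if for all $\varphi\in\operatorname{dom}F$ and $q'\in Q'$ there is a finite list $L$ in $Q$ such that $F(\psi)(q')=F(\varphi)(q')$ for all $\psi\in\operatorname{dom}F$ that agree with $\varphi$ on $L$. A function $f\colon\mathbf X\to\mathbf Y$ is realized by $F$ if for each name $\varphi$ of each $x\in X$ the value $F(\varphi)$ is defined and is a name of $f(x)$; $f$ is continuous if it is realized by a continuous partial operator. An isomorphism is a continuous bijection with continuous inverse, and $\mathbf X\simeq\mathbf Y$ means that there is one. The space $\mathbf Y^{\mathbf X}$ consists of the continuous functions $f\colon\mathbf X\to\mathbf Y$; its questions are the pairs $(\mathbf a,q')$ of a finite list $\mathbf a$ in $A_{\mathbf X}$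 and $q'\in Q_{\mathbf Y}$, its answers are the finite lists in $Q_{\mathbf X}$ and the elements of $A_{\mathbf Y}$ (disjoint union), and $\psi$ is a name of $f$ if $F_{U(\psi)}$ realizes $f$. Here $F_{U(\psi)}(\varphi)(q')$ is obtained by evaluating $\psi$ at $(\mathbf a,q')$, starting with the empty list $\mathbf a$: whenever the result is a list $(q_1,\dots,q_k)$ in $Q_{\mathbf X}$, append $\varphi(q_1),\dots,\varphi(q_k)$ to $\mathbf a$ and repeat; when it is an element of $A_{\mathbf Y}$, this is the value. $F_{U(\psi)}(\varphi)$ is defined if this process terminates for every $q'$. $\mathbb N$ is represented with one question $\star$ and $\varphi\in\mathbb N^{\{\star\}}$ naming $\varphi(\star)$. Sierpiński space $\mathbb S=\{\bot,\top\}$ is represented by $\delta_{\mathbb S}\colon\{\mathrm{true},\mathrm{false}\}^{\mathbb N}\to\mathbb S$ with $\delta_{\mathbb S}(\varphi)=\top$ iff $\varphi(n)=\mathrm{true}$ for some $n$. For $U\subseteq\mathbb N$ let $\chi_U\colon\mathbb N\to\mathbb S$ have value $\top$ exactly on $U$. * $\mathcal O(\mathbb N):=\mathbb S^{\mathbb N}$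 (function space), the open subsets of $\mathbb N$ given through their characteristic functions. * $\mathcal A(\mathbb N)$: the subsets $C\subseteq\mathbb N$ with $\chi_{\mathbb N\setminus C}$ continuous; a name of $C$ is an $\mathcal O(\mathbb N)$-name of $\chi_{\mathbb N\setminus C}$. * $\mathcal O_{\mathbb N}$: the subsets of $\mathbb N$, with $\varphi\colon\mathbb N\to\mathbb N$ naming $\{n\mid\exists m\colon\varphi(m)=n+1\}$. * $\mathcal A_{\mathbb N}$: the subsets of $\mathbb N$, with $\varphi\colon\mathbb N\to\mathbb N$ naming $\mathbb N\setminus\{n\mid\exists m\colon\varphi(m)=n+1\}$. **Theorem.** $\mathcal A(\mathbb N)\simeq\mathcal O(\mathbb N)$, $\mathcal A(\mathbb N)\simeq\mathcal A_{\mathbb N}$ and $\mathcal O(\mathbb N)\simeq\mathcal O_{\mathbb N}$. More precisely, the following maps are isomorphisms of represented spaces: 1. complementation $\mathcal A(\mathbb N)\to\mathcal O(\mathbb N)$, $C\mapsto\chi_{\mathbb N\setminus C}$; 2. $\mathcal A(\mathbb N)\to\mathcal A_{\mathbb N}$, $C\mapsto C$; 3. $\mathcal O(\mathbb N)\to\mathcal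 O_{\mathbb N}$, $f\mapsto\{n\mid f(n)=\top\}$. -/

import Mathlib

namespace RepSpaces

/-! ### Multifunctions and operators between naming spaces -/

/-- A multivalued function assigns to each input a possibly empty set of eligible return values. -/
abbrev Multifunction (S T : Type) : Type := S → Set T

/-- The domain of a multifunction. -/
def Multifunction.dom {S T : Type} (F : Multifunction S T) : Set S := {s | (F s).Nonempty}

/-- Two functions coincide on a finite list of arguments. -/
def CoincideOn {Q A : Type} (φ ψ : Q → A) (L : List Q) : Prop := ∀ q ∈ L, φ q = ψ q

/-- The list `L` certifies the value at `q'` of the results of `F` on input `φ`. -/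
def IsCertificate {Q A Q' A' : Type} (F : Multifunction (Q → A) (Q' → A'))
    (φ : Q → A) (q' : Q') (L : List Q) : Prop :=
  ∀ ψ : Q → A, CoincideOn φ ψ L → ∀ φ' ∈ F φ, ∀ ψ' ∈ F ψ, φ' q' = ψ' q'

/-- Continuity of a partial operator, given as a multifunction. A continuous multifunction is
automatically singlevalued (take `ψ = φ` in `IsCertificate`), i.e. is a partial operator. -/
def IsContinuousOperator {Q A Q' A' : Type} (F : Multifunction (Q → A) (Q' → A')) : Prop :=
  ∀ φ ∈ F.dom, ∀ q' : Q', ∃ L : List Q, IsCertificate F φ q' L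

/-- The operator `F_M` specified by a function `M` with an additional effort parameter. -/
def operatorOf {Q A Q' A' : Type} (M : ℕ → (Q → A) → Q' → Option A') :
    Multifunction (Q → A) (Q' → A') :=
  fun φ => {φ' | ∀ q', ∃ n, M n φ q' = some (φ' q')}

/-- At most `n` rounds of evaluating `ψ`, started with the list `l` of answers collected so far:
if `ψ` returns a list of questions, then the answers of `φ` to them are appended to `l` and the
evaluation continues; if `ψ` returns an answer, it is the result. -/
def evalRounds {Q A Q' A' : Type} (ψ : List A × Q' → List Q ⊕ A') (φ : Q → A) (q' : Q') :
    ℕ → List A → Option A'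
  | 0, _ => none
  | n + 1, l =>
    match ψ (l, q') with
    | Sum.inl qs => evalRounds ψ φ q' n (l ++ qs.map φ)
    | Sum.inr a' => some a'

/-- The universal: the evaluation starts with the empty list of answers. -/
def universal {Q A Q' A' : Type} (ψ : List A × Q' → List Q ⊕ A') :
    ℕ → (Q → A) → Q' → Option A' :=
  fun n φ q' => evalRounds ψ φ q' n []

/-! ### Represented spaces -/

/-- A represented space: a set together with a naming space `Q → A` (with `Q` and `A` countable
and non-empty) and a singlevalued, co-total multifunction `δ` from the naming space to the set. -/
structure RepresentedSpace where
  /-- the underlying set -/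
  Carrier : Type
  /-- the questions -/
  Q : Type
  /-- the answers -/
  A : Type
  countable_Q : Countable Q
  nonempty_Q : Nonempty Q
  countable_A : Countable A
  nonempty_A : Nonempty A
  /-- the representation; `x ∈ δ φ` means that `φ` is a name of `x` -/
  δ : Multifunction (Q → A) Carrier
  singlevalued : ∀ φ x y, x ∈ δ φ → y ∈ δ φ → x = y
  cototal : ∀ x, ∃ φ, x ∈ δ φ

/-- `F` realizes `f`: on each name of `x` it is defined and returns a name of `f x`. -/
def IsRealizer (X Y : RepresentedSpace) (F : Multifunction (X.Q → X.A) (Y.Q → Y.A))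
    (f : X.Carrier → Y.Carrier) : Prop :=
  ∀ φ x, x ∈ X.δ φ → φ ∈ F.dom ∧ ∀ φ' ∈ F φ, f x ∈ Y.δ φ'

/-- A function between represented spaces is continuous if it has a continuous realizer. -/
def IsContinuous (X Y : RepresentedSpace) (f : X.Carrier → Y.Carrier) : Prop :=
  ∃ F : Multifunction (X.Q → X.A) (Y.Q → Y.A), IsContinuousOperator F ∧ IsRealizer X Y F f

/-- An isomorphism: a continuous bijection with continuous inverse. -/
def IsIsomorphism (X Y : RepresentedSpace) (f : X.Carrier → Y.Carrier) : Prop :=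
  IsContinuous X Y f ∧ ∃ g : Y.Carrier → X.Carrier,
    Function.LeftInverse g f ∧ Function.RightInverse g f ∧ IsContinuous Y X g

/-! ### The function space -/

theorem evalRounds_unique {Q A Q' A' : Type} (ψ : List A × Q' → List Q ⊕ A') (φ : Q → A)
    (q' : Q') : ∀ (n m : ℕ) (l : List A) (a b : A'),
      evalRounds ψ φ q' n l = some a → evalRounds ψ φ q' m l = some b → a = b := by
  intro n
  induction n with
  | zero => intro m l a b h; simp [evalRounds] at h
  | succ n ih =>
    intro m l a b h h'
    cases m with
    | zero => simp [evalRounds] at h'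
    | succ m =>
      rw [evalRounds] at h h'
      cases hψ : ψ (l, q') with
      | inl qs => rw [hψ] at h h'; exact ih _ _ _ _ h h'
      | inr a' => rw [hψ] at h h'; simp_all

/-- Every continuous operator `F` has an associate: a `ψ` such that the operator coded by `ψ`
tightens `F`. -/
theorem exists_associate {Q A Q' A' : Type} [Countable Q] [Nonempty Q]
    (F : Multifunction (Q → A) (Q' → A')) (hF : IsContinuousOperator F) :
    ∃ ψ : List A × Q' → List Q ⊕ A', ∀ φ ∈ F.dom,
      φ ∈ (operatorOf (universal ψ)).dom ∧ operatorOf (universal ψ) φ ⊆ F φ := by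
  classical
  obtain ⟨e, he⟩ := exists_surjective_nat Q
  let ext : List A → (Q → A) → Prop := fun l φ => (List.range l.length).map (fun i => φ (e i)) = l
  let forced : List A → Q' → A' → Prop := fun l q' a' =>
    ∀ φ, ext l φ → ∀ φ' ∈ F φ, φ' q' = a'
  let ψ : List A × Q' → List Q ⊕ A' := fun p =>
    if h : ∃ a', forced p.1 p.2 a' then Sum.inr h.choose else Sum.inl [e p.1.length]
  let ini : (Q → A) → ℕ → List A := fun φ n => (List.range n).map (fun i => φ (e i))
  have hext : ∀ φ n, ext (ini φ n) φ := by intro φ n; simp [ext, ini]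
  have key : ∀ φ, ∀ φ' ∈ F φ, ∀ q', ∃ n, universal ψ n φ q' = some (φ' q') := by
    intro φ φ' hφ' q'
    obtain ⟨L, hL⟩ := hF φ ⟨φ', hφ'⟩ q'
    have hN : ∃ N, ∀ q ∈ L, ∃ i < N, e i = q := by
      clear hL
      induction L with
      | nil => exact ⟨0, by simp⟩
      | cons q L ih =>
        obtain ⟨N, hN⟩ := ih
        obtain ⟨j, hj⟩ := he q
        refine ⟨max N (j + 1), ?_⟩
        intro r hr
        rcases List.mem_cons.1 hr with rfl | hr
        · exact ⟨j, by omega, hj⟩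
        · obtain ⟨i, hi, h⟩ := hN r hr
          exact ⟨i, by omega, h⟩
    obtain ⟨N, hN⟩ := hN
    have hforced : forced (ini φ N) q' (φ' q') := by
      intro χ hχ χ' hχ'
      refine (hL χ ?_ φ' hφ' χ' hχ').symm
      intro q hq
      obtain ⟨i, hi, rfl⟩ := hN q hq
      simp only [ext, ini, List.length_map, List.length_range] at hχ
      exact (List.map_inj_left.1 hχ i (List.mem_range.2 hi)).symm
    have step : ∀ k n, n + k = N →
        ∃ m, evalRounds ψ φ q' m (ini φ n) = some (φ' q') := by
      intro k
      induction k with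
      | zero =>
        intro n hn
        obtain rfl : n = N := by omega
        have h : ∃ a', forced (ini φ n) q' a' := ⟨_, hforced⟩
        refine ⟨1, ?_⟩
        have : ψ (ini φ n, q') = Sum.inr h.choose := dif_pos h
        rw [evalRounds, this]
        exact congrArg some (h.choose_spec φ (hext φ n) φ' hφ').symm
      | succ k ih =>
        intro n hn
        by_cases h : ∃ a', forced (ini φ n) q' a'
        · refine ⟨1, ?_⟩
          have : ψ (ini φ n, q') = Sum.inr h.choose := dif_pos h
          rw [evalRounds, this]
          exact congrArg some (h.choose_spec φ (hext φ n) φ' hφ').symm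
        · obtain ⟨m, hm⟩ := ih (n + 1) (by omega)
          refine ⟨m + 1, ?_⟩
          have : ψ (ini φ n, q') = Sum.inl [e (ini φ n).length] := dif_neg h
          rw [evalRounds, this]
          simpa [ini, List.range_succ] using hm
    exact step N 0 (by omega)
  refine ⟨ψ, ?_⟩
  rintro φ ⟨φ', hφ'⟩
  refine ⟨⟨φ', key φ φ' hφ'⟩, ?_⟩
  intro χ hχ
  have : χ = φ' := by
    funext q'
    obtain ⟨n, hn⟩ := hχ q'
    obtain ⟨m, hm⟩ := key φ φ' hφ' q'
    exact evalRounds_unique ψ φ q' n m [] _ _ hn hm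
  rwa [this]

/-- The space `Y ^ X` of continuous functions: `ψ` is a name of `f` if the operator that `ψ` codes
through the universal realizes `f`. -/
abbrev functionSpace (X Y : RepresentedSpace) : RepresentedSpace where
  Carrier := {f : X.Carrier → Y.Carrier // IsContinuous X Y f}
  Q := List X.A × Y.Q
  A := List X.Q ⊕ Y.A
  countable_Q := by
    have := X.countable_A; have := Y.countable_Q; infer_instance
  nonempty_Q := by
    have := Y.nonempty_Q; infer_instance
  countable_A := by
    have := X.countable_Q; have := Y.countable_A; infer_instance
  nonempty_A := by
    have := Y.nonempty_A; infer_instance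
  δ := fun ψ => {f | IsRealizer X Y (operatorOf (universal ψ)) f.1}
  singlevalued := by
    intro ψ f g hf hg
    apply Subtype.ext
    funext x
    obtain ⟨φ, hφ⟩ := X.cototal x
    obtain ⟨⟨φ', hφ'⟩, h⟩ := hf φ x hφ
    exact Y.singlevalued φ' _ _ (h φ' hφ') ((hg φ x hφ).2 φ' hφ')
  cototal := by
    rintro ⟨f, F, hF, hr⟩
    have := X.countable_Q
    have := X.nonempty_Q
    obtain ⟨ψ, hψ⟩ := exists_associate F hF
    refine ⟨ψ, ?_⟩
    intro φ x hx
    obtain ⟨hd, hv⟩ := hr φ x hx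
    exact ⟨(hψ φ hd).1, fun φ' hφ' => hv φ' ((hψ φ hd).2 hφ')⟩

/-! ### Natural numbers, Sierpinski space, and hyperspaces -/

/-- The discrete represented space of natural numbers: there is a single question, and a name
answers it with the number. -/
abbrev natSpace : RepresentedSpace where
  Carrier := ℕ
  Q := Unit
  A := ℕ
  countable_Q := inferInstance
  nonempty_Q := inferInstance
  countable_A := inferInstance
  nonempty_A := inferInstance
  δ := fun φ => {φ ()}
  singlevalued := by
    intro φ x y hx hy
    exact (Set.mem_singleton_iff.1 hx).trans (Set.mem_singleton_iff.1 hy).symm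
  cototal := fun n => ⟨fun _ => n, rfl⟩

/-- The points of Sierpinski space. -/
inductive Sierpinski : Type
  | bot : Sierpinski
  | top : Sierpinski

/-- Sierpinski space: a sequence of Booleans is a name of `top` if it takes the value `true`
somewhere, and a name of `bot` otherwise. -/
abbrev sierpinskiSpace : RepresentedSpace where
  Carrier := Sierpinski
  Q := ℕ
  A := Bool
  countable_Q := inferInstance
  nonempty_Q := inferInstance
  countable_A := inferInstance
  nonempty_A := inferInstance
  δ := fun φ => {s | s = Sierpinski.top ↔ ∃ n, φ n = true}
  singlevalued := by
    intro φ x y hx hy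
    have h : x = Sierpinski.top ↔ y = Sierpinski.top := Iff.trans hx (Iff.symm hy)
    cases x <;> cases y <;> simp_all
  cototal := by
    intro s
    cases s with
    | bot => exact ⟨fun _ => false, by simp⟩
    | top => exact ⟨fun _ => true, by simp⟩

open Classical in
/-- The characteristic function of a subset, with values in Sierpinski space. -/
noncomputable def charFun {X : Type} (U : Set X) : X → Sierpinski :=
  fun x => if x ∈ U then Sierpinski.top else Sierpinski.bot

theorem charFun_eq_top {X : Type} (U : Set X) (x : X) :
    charFun U x = Sierpinski.top ↔ x ∈ U := by
  unfold charFun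
  split_ifs with h <;> simp [h]

/-- The space of open subsets of `X`, i.e. the space of continuous functions from `X` to
Sierpinski space (the characteristic functions of the open subsets). -/
abbrev opens (X : RepresentedSpace) : RepresentedSpace := functionSpace X sierpinskiSpace

/-- The space of closed subsets of `X`: the subsets whose complement is open, a name of such a set
being a name of (the characteristic function of) its complement. -/
abbrev closeds (X : RepresentedSpace) : RepresentedSpace where
  Carrier := {C : Set X.Carrier // IsContinuous X sierpinskiSpace (charFun Cᶜ)}
  Q := (opens X).Q
  A := (opens X).A
  countable_Q := (opens X).countable_Q
  nonempty_Q := (opens X).nonempty_Q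
  countable_A := (opens X).countable_A
  nonempty_A := (opens X).nonempty_A
  δ := fun ψ => {C | (⟨charFun C.1ᶜ, C.2⟩ : (opens X).Carrier) ∈ (opens X).δ ψ}
  singlevalued := by
    intro ψ C D hC hD
    have h : charFun C.1ᶜ = charFun D.1ᶜ :=
      congrArg Subtype.val ((opens X).singlevalued ψ _ _ hC hD)
    apply Subtype.ext
    apply compl_injective
    ext x
    rw [← charFun_eq_top, ← charFun_eq_top, h]
  cototal := fun C => (opens X).cototal ⟨charFun C.1ᶜ, C.2⟩

/-- The set enumerated by `φ`; the value `0` of `φ` stands for no element, `n + 1` for `n`. -/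
def enumeratedSet (φ : ℕ → ℕ) : Set ℕ := {n | ∃ m, φ m = n + 1}

theorem exists_enumeration (U : Set ℕ) : ∃ φ, U = enumeratedSet φ := by
  classical
  refine ⟨fun m => if m ∈ U then m + 1 else 0, ?_⟩
  ext n
  constructor
  · intro h
    exact ⟨n, if_pos h⟩
  · rintro ⟨m, hm⟩
    dsimp only at hm
    split_ifs at hm with h
    obtain rfl : m = n := by omega
    exact h

/-- Subsets of the natural numbers, a name of a set being an enumeration of its elements. -/
abbrev enumOpens : RepresentedSpace where
  Carrier := Set ℕ
  Q := ℕ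
  A := ℕ
  countable_Q := inferInstance
  nonempty_Q := inferInstance
  countable_A := inferInstance
  nonempty_A := inferInstance
  δ := fun φ => {enumeratedSet φ}
  singlevalued := by
    intro φ x y hx hy
    exact (Set.mem_singleton_iff.1 hx).trans (Set.mem_singleton_iff.1 hy).symm
  cototal := fun U => exists_enumeration U

/-- Subsets of the natural numbers, a name of a set being an enumeration of its complement. -/
abbrev enumCloseds : RepresentedSpace where
  Carrier := Set ℕ
  Q := ℕ
  A := ℕ
  countable_Q := inferInstance
  nonempty_Q := inferInstance
  countable_A := inferInstance
  nonempty_A := inferInstance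
  δ := fun φ => {(enumeratedSet φ)ᶜ}
  singlevalued := by
    intro φ x y hx hy
    exact (Set.mem_singleton_iff.1 hx).trans (Set.mem_singleton_iff.1 hy).symm
  cototal := by
    intro C
    obtain ⟨φ, hφ⟩ := exists_enumeration Cᶜ
    exact ⟨φ, by rw [Set.mem_singleton_iff, ← hφ, compl_compl]⟩

end RepSpaces

namespace RepSpaces

/-! Every function from `natSpace` to Sierpinski space is continuous, because the single answer in a
name of `n` already determines `n`. Hence all carriers are in effect the power set of the natural
numbers, and only the translation of names is at stake. Complementation leaves names untouched. A
function-space name `ψ` becomes an enumeration by dovetailing over the number, the position in its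
Sierpinski name and a bound on the rounds; the bound makes each output depend on finitely many
values of `ψ` (`exists_evalRounds_congr`). Conversely, an enumeration `φ` becomes a function-space
name that reads `n` and tests at position `m` whether `φ m = n + 1`, which uses one value of `φ`. -/

/-- A total map each of whose output values depends on finitely many input values yields a
continuous function, if it sends names of `x` to names of `f x`. -/
theorem isContinuous_of_map {X Y : RepresentedSpace} {f : X.Carrier → Y.Carrier}
    (G : (X.Q → X.A) → Y.Q → Y.A)
    (hG : ∀ φ q', ∃ L, ∀ ψ, CoincideOn φ ψ L → G φ q' = G ψ q')
    (hf : ∀ φ x, x ∈ X.δ φ → f x ∈ Y.δ (G φ)) : IsContinuous X Y f := by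
  refine ⟨fun φ => {G φ}, ?_, ?_⟩
  · intro φ _ q'
    obtain ⟨L, hL⟩ := hG φ q'
    refine ⟨L, ?_⟩
    rintro ψ hψ _ rfl _ rfl
    exact hL ψ hψ
  · intro φ x hx
    refine ⟨⟨G φ, rfl⟩, ?_⟩
    rintro _ rfl
    exact hf φ x hx

/-! ### From function-space names to enumerations. -/

/-- The result of finitely many rounds of evaluating `ψ` depends on finitely many values of `ψ`. -/
theorem exists_evalRounds_congr {Q A Q' A' : Type} (ψ : List A × Q' → List Q ⊕ A') (φ : Q → A)
    (q' : Q') (n : ℕ) (l : List A) : ∃ L, ∀ χ, CoincideOn ψ χ L →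
      evalRounds ψ φ q' n l = evalRounds χ φ q' n l := by
  induction n generalizing l with
  | zero => exact ⟨[], fun _ _ => rfl⟩
  | succ n ih =>
    cases h : ψ (l, q') with
    | inl qs =>
      obtain ⟨L, hL⟩ := ih (l ++ qs.map φ)
      -- Agreement at the current query forces `χ` to ask the same questions, so both evaluations
      -- continue from the same list.
      refine ⟨(l, q') :: L, fun χ hχ => ?_⟩
      have h' := hχ (l, q') List.mem_cons_self
      rw [evalRounds, evalRounds, ← h', h]
      exact hL χ fun q hq => hχ q (List.mem_cons_of_mem _ hq)
    | inr a' =>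
      refine ⟨[(l, q')], fun χ hχ => ?_⟩
      rw [evalRounds, evalRounds, ← hχ (l, q') List.mem_cons_self, h]

/-- If `ψ` names an open set `U` of natural numbers, then `enumerationOfName ψ` enumerates `U`: on
input `⟨n, k, r⟩` it returns `n` if the `k`-th entry of the Sierpinski name that `ψ` assigns to `n`
is found to be `true` within `r` rounds. -/
def enumerationOfName (ψ : List ℕ × ℕ → List Unit ⊕ Bool) (m : ℕ) : ℕ :=
  if universal ψ m.unpair.2.unpair.2 (fun _ => m.unpair.1) m.unpair.2.unpair.1 = some true then
    m.unpair.1 + 1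
  else 0

theorem mem_enumeratedSet_enumerationOfName (ψ : List ℕ × ℕ → List Unit ⊕ Bool) (n : ℕ) :
    n ∈ enumeratedSet (enumerationOfName ψ) ↔
      ∃ k r, universal ψ r (fun _ => n) k = some true := by
  constructor
  · rintro ⟨m, hm⟩
    unfold enumerationOfName at hm
    -- The default value `0` is never of the form `n + 1`, so only the successful branch survives.
    split_ifs at hm with h
    rw [Nat.add_right_cancel hm] at h
    exact ⟨_, _, h⟩
  · rintro ⟨k, r, h⟩
    exact ⟨Nat.pair n (Nat.pair k r), by simp [enumerationOfName, h]⟩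

theorem enumerationOfName_congr (ψ : List ℕ × ℕ → List Unit ⊕ Bool) (m : ℕ) :
    ∃ L, ∀ χ, CoincideOn ψ χ L → enumerationOfName ψ m = enumerationOfName χ m := by
  obtain ⟨L, hL⟩ := exists_evalRounds_congr ψ (fun _ => m.unpair.1) m.unpair.2.unpair.1
    m.unpair.2.unpair.2 []
  refine ⟨L, fun χ hχ => ?_⟩
  unfold enumerationOfName universal
  rw [hL χ hχ]

/-- The realizer is defined on the constant name of `n`, so each position is computed within some
number of rounds; by `evalRounds_unique` no other bound gives a different answer. -/
theorem enumeratedSet_enumerationOfName {ψ : List ℕ × ℕ → List Unit ⊕ Bool}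
    {f : ℕ → Sierpinski}
    (hf : IsRealizer natSpace sierpinskiSpace (operatorOf (universal ψ)) f) :
    enumeratedSet (enumerationOfName ψ) = {n | f n = Sierpinski.top} := by
  ext n
  obtain ⟨⟨φ', hφ'⟩, h⟩ := hf (fun _ => n) n rfl
  have hn : f n = Sierpinski.top ↔ ∃ k, φ' k = true := h φ' hφ'
  rw [mem_enumeratedSet_enumerationOfName, Set.mem_ofPred_eq, hn]
  refine exists_congr fun k => ?_
  obtain ⟨r, hr⟩ := hφ' k
  constructor
  · rintro ⟨s, hs⟩
    exact evalRounds_unique ψ _ k r s [] _ _ hr hs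
  · intro hk
    exact ⟨r, by rw [hr, hk]⟩

/-! ### From enumerations to function-space names. -/

/-- A name of the set enumerated by `φ` as an open set: ask for the number `n`, and then return
whether `φ m` stands for `n`. -/
def nameOfEnumeration (φ : ℕ → ℕ) : List ℕ × ℕ → List Unit ⊕ Bool
  | ([], _) => Sum.inl [()]
  | (n :: _, m) => Sum.inr (decide (φ m = n + 1))

theorem nameOfEnumeration_congr (φ : ℕ → ℕ) (p : List ℕ × ℕ) :
    ∃ L, ∀ χ, CoincideOn φ χ L → nameOfEnumeration φ p = nameOfEnumeration χ p := by
  refine ⟨[p.2], fun χ hχ => ?_⟩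
  have h : φ p.2 = χ p.2 := hχ p.2 List.mem_cons_self
  obtain ⟨_ | ⟨n, l⟩, m⟩ := p
  · rfl
  · simp only [nameOfEnumeration, h]

theorem isRealizer_nameOfEnumeration {φ : ℕ → ℕ} {f : ℕ → Sierpinski}
    (hf : ∀ n, f n = Sierpinski.top ↔ n ∈ enumeratedSet φ) :
    IsRealizer natSpace sierpinskiSpace (operatorOf (universal (nameOfEnumeration φ))) f := by
  rintro p _ rfl
  -- Two rounds suffice: one asks the only question, the other decides on the list `[p ()]`.
  have key : ∀ m, universal (nameOfEnumeration φ) 2 p m = some (decide (φ m = p () + 1)) :=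
    fun _ => rfl
  refine ⟨⟨fun m => decide (φ m = p () + 1), fun m => ⟨2, key m⟩⟩, fun φ' hφ' => ?_⟩
  refine (hf (p ())).trans (exists_congr fun m => ?_)
  obtain ⟨r, hr⟩ := hφ' m
  rw [evalRounds_unique _ p m r 2 [] _ _ hr (key m), decide_eq_true_iff]

/-- The truth value of being the point `top`. -/
def Sierpinski.toBool : Sierpinski → Bool
  | bot => false
  | top => true

/-- The realizer outputs a constant Boolean sequence chosen by the single answer; it need not be
computable. -/
theorem isContinuous_natSpace_sierpinskiSpace (f : ℕ → Sierpinski) :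
    IsContinuous natSpace sierpinskiSpace f := by
  refine isContinuous_of_map (X := natSpace) (Y := sierpinskiSpace)
    (fun φ _ => (f (φ ())).toBool) (fun φ _ => ⟨[()], fun ψ h => ?_⟩) ?_
  · rw [h () List.mem_cons_self]
  · rintro φ _ rfl
    cases h : f (φ ()) <;> simp [Sierpinski.toBool]

theorem charFun_setOf_eq_top {X : Type} (f : X → Sierpinski) :
    charFun {x | f x = Sierpinski.top} = f := by
  funext x
  have h := charFun_eq_top {x | f x = Sierpinski.top} x
  rw [Set.mem_ofPred_eq] at h
  cases h₁ : f x <;> cases h₂ : charFun {x | f x = Sierpinski.top} x <;> simp_all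

/-! ### The three isomorphisms. -/

/-- Complementation identifies closed and open subsets. -/
noncomputable def complement (C : (closeds natSpace).Carrier) : (opens natSpace).Carrier :=
  ⟨charFun C.1ᶜ, C.2⟩

theorem isIsomorphism_complement :
    IsIsomorphism (closeds natSpace) (opens natSpace) complement := by
  have hcompl (U : (opens natSpace).Carrier) :
      charFun ({n | U.1 n = Sierpinski.top}ᶜ)ᶜ = U.1 := by
    rw [compl_compl, charFun_setOf_eq_top]
  -- The identity on names realizes both directions; each output value needs one input value.
  refine ⟨isContinuous_of_map (fun ψ => ψ) (fun ψ q => ⟨[q], fun χ h => ?_⟩) fun ψ C hC => hC,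
    fun U => ⟨{n | U.1 n = Sierpinski.top}ᶜ, isContinuous_natSpace_sierpinskiSpace _⟩,
    fun C => ?_, fun U => Subtype.ext (hcompl U),
    isContinuous_of_map (fun ψ => ψ) (fun ψ q => ⟨[q], fun χ h => ?_⟩) fun ψ U hU => ?_⟩
  · exact h q List.mem_cons_self
  · apply Subtype.ext
    ext n
    simp [complement, charFun_eq_top]
  · exact h q List.mem_cons_self
  · change IsRealizer natSpace sierpinskiSpace (operatorOf (universal ψ))
      (charFun ({n | U.1 n = Sierpinski.top}ᶜ)ᶜ)
    rw [hcompl]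
    exact hU

/-- Both representations describe a set through its complement, so the translations used for open
sets apply unchanged. -/
theorem isIsomorphism_closeds_enumCloseds :
    IsIsomorphism (closeds natSpace) enumCloseds (fun C => C.1) := by
  refine ⟨isContinuous_of_map (X := closeds natSpace) (Y := enumCloseds)
      enumerationOfName enumerationOfName_congr fun ψ C hC => ?_,
    fun C => ⟨C, isContinuous_natSpace_sierpinskiSpace _⟩, fun _ => rfl, fun _ => rfl,
    isContinuous_of_map (X := enumCloseds) (Y := closeds natSpace)
      nameOfEnumeration nameOfEnumeration_congr ?_⟩
  · change C.1 = (enumeratedSet (enumerationOfName ψ))ᶜ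
    rw [enumeratedSet_enumerationOfName hC]
    ext n
    simp [charFun_eq_top]
  · rintro φ _ rfl
    exact isRealizer_nameOfEnumeration fun n => by rw [charFun_eq_top, compl_compl]

theorem isIsomorphism_opens_enumOpens :
    IsIsomorphism (opens natSpace) enumOpens (fun U => {n : ℕ | U.1 n = Sierpinski.top}) := by
  refine ⟨isContinuous_of_map (X := opens natSpace) (Y := enumOpens)
      enumerationOfName enumerationOfName_congr
      fun ψ U hU => (enumeratedSet_enumerationOfName hU).symm,
    fun U => ⟨charFun U, isContinuous_natSpace_sierpinskiSpace _⟩,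
    fun U => Subtype.ext (charFun_setOf_eq_top U.1), fun U => Set.ext fun n => charFun_eq_top U n,
    isContinuous_of_map (X := enumOpens) (Y := opens natSpace)
      nameOfEnumeration nameOfEnumeration_congr ?_⟩
  rintro φ _ rfl
  exact isRealizer_nameOfEnumeration fun n => charFun_eq_top _ n

end RepSpaces

theorem mainTheorem2 :
    (∃ f : (RepSpaces.closeds RepSpaces.natSpace).Carrier →
          (RepSpaces.opens RepSpaces.natSpace).Carrier,
      RepSpaces.IsIsomorphism (RepSpaces.closeds RepSpaces.natSpace)
        (RepSpaces.opens RepSpaces.natSpace) f ∧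
      ∀ C, (f C).1 = RepSpaces.charFun C.1ᶜ) ∧
    (∃ f : (RepSpaces.closeds RepSpaces.natSpace).Carrier → RepSpaces.enumCloseds.Carrier,
      RepSpaces.IsIsomorphism (RepSpaces.closeds RepSpaces.natSpace) RepSpaces.enumCloseds f ∧
      ∀ C, f C = C.1) ∧
    (∃ f : (RepSpaces.opens RepSpaces.natSpace).Carrier → RepSpaces.enumOpens.Carrier,
      RepSpaces.IsIsomorphism (RepSpaces.opens RepSpaces.natSpace) RepSpaces.enumOpens f ∧
      ∀ U, f U = {n : ℕ | U.1 n = RepSpaces.Sierpinski.top}) :=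
  ⟨⟨_, RepSpaces.isIsomorphism_complement, fun _ => rfl⟩,
    ⟨_, RepSpaces.isIsomorphism_closeds_enumCloseds, fun _ => rfl⟩,
    ⟨_, RepSpaces.isIsomorphism_opens_enumOpens, fun _ => rfl⟩⟩
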